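/- Let $V$ be a finite-dimensional real vector space, $\Delta\subset V$ an irreducible reduced crystallographic root system (for example the root system of a simple complex Lie algebra $\mathfrak g$ with respect to a Cartan subalgebra $\mathfrak t$, with $V=\mathfrak t_{\mathbb R}$), and $(\cdot,\cdot)$ an inner product on $V$ invariant under the Weyl group. Assume that $\Delta$ has two root lengths, and call a root long or short accordingly. Let $\Delta^+$ be a system of positive roots, $\Pi=\{\alpha_1,\dots,\alpha_p\}$ its simple roots, and $\theta$ the highest root. Let $\widehat V=V\oplus\mathbb R\delta\oplus\mathbb R\lambda$, with $(\cdot,\cdot)$ extended by $(\delta,V)=(\lambda,V)=(\delta,\delta)=(\lambda,\lambda)=0$ and $(\delta,\lambda)=1$. Let $\widehat\Delta^+=\Delta^+\cup\{\alpha+k\delta \mid \alpha\in\Delta,\ k\in\mathbb Z,\ k\ge 1\}$ be the set of positive affine real roots, put $\alpha_0=\delta-\theta$, let $s_i$ $(0\le i\le p)$ be the orthogonal reflection of $\widehat V$ in $\alpha_i$, and let $\widehat W\subset GL(\widehat V)$ be the affine Weyl group, generated by $s_0,\dots,s_p$. For $i\ge 1$ the reflection $s_i$ is called short if $\alpha_i$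 is short; $s_0$ is regarded as long. A reduced decomposition of $w\in\widehat W$ is an expression $w=s_{i_1}\cdots s_{i_k}$ with $k$ minimal. For $w\in\widehat W$ put $\widehat N(w)=\{\alpha\in\widehat\Delta^+\mid w(\alpha)\in-\widehat\Delta^+\}$. The element $w$ is called minuscule if $\widehat N(w)=\{\delta-\gamma\mid\gamma\in I\}$ for some subset $I\subset\Delta^+$; then put $I_w=\{\gamma\in\Delta^+\mid\delta-\gamma\in\widehat N(w)\}$. An Abelian ideal is a subset $I\subset\Delta^+$ such that (a) $\mu+\nu\notin\Delta$ for all $\mu,\nu\in I$, and (b) if $\gamma\in I$, $\nu\in\Delta^+$ and $\gamma+\nu\in\Delta$, then $\gamma+\nu\in I$. It is called long if all its elements are long roots. Let $\mathcal M_l$ be the set of minuscule elements $w$ such that $I_w$ is a long Abelian ideal. Proposition. Let $w\in\widehat W$ be minuscule. Then $w\in\mathcal M_l$ if and only if no reduced decomposition of $w$ contains a short simple reflection. -/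

import Mathlib

noncomputable section

namespace LongAbelian

variable {ι V N : Type*} [AddCommGroup V] [Module ℝ V] [AddCommGroup N] [Module ℝ N]
  {P : RootPairing ι ℝ V N}

/-- The set `Δ⁺` of positive roots, as a subset of `V`. -/
def posRoots [P.IsReduced] [Finite ι] (b : P.Base) : Set V :=
  {γ | ∃ i, b.IsPos i ∧ P.root i = γ}

/-- `θ` is (the index of) the highest root: for every root `β`, the difference `θ - β` is a
combination of simple roots with non-negative integer coefficients. -/
def IsHighestRoot (b : P.Base) (θ : ι) : Prop :=
  ∀ i, P.root θ - P.root i ∈ AddSubmonoid.closure (P.root '' b.support)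

/-- The root `P.root i` is long: it has maximal length among all roots. -/
def IsLong (B : P.InvariantForm) (i : ι) : Prop :=
  ∀ j, B.form (P.root j) (P.root j) ≤ B.form (P.root i) (P.root i)

/-- The root `P.root i` is short: there is a strictly longer root. (If there are exactly two root
lengths, these are the roots of the smaller length.) -/
def IsShort (B : P.InvariantForm) (i : ι) : Prop :=
  ∃ j, B.form (P.root i) (P.root i) < B.form (P.root j) (P.root j)

/-- The set `Δ⁺_l` of long positive roots. -/
def longPosRoots [P.IsReduced] [Finite ι] (b : P.Base) (B : P.InvariantForm) : Set V :=
  {γ | ∃ i, b.IsPos i ∧ IsLong B i ∧ P.root i = γ}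

/-- Combinatorial Abelian ideals: `I ⊆ Δ⁺` such that (a) the sum of two elements of `I` is never a
root; (b) if `γ ∈ I`, `ν ∈ Δ⁺` and `γ + ν` is a root, then `γ + ν ∈ I`. -/
structure IsAbelianIdeal [P.IsReduced] [Finite ι] (b : P.Base) (I : Set V) : Prop where
  subset_posRoots : I ⊆ posRoots b
  add_notMem : ∀ μ ∈ I, ∀ ν ∈ I, μ + ν ∉ Set.range P.root
  add_mem : ∀ γ ∈ I, ∀ ν ∈ posRoots b, γ + ν ∈ Set.range P.root → γ + ν ∈ I

/-- An Abelian ideal is long if it consists of long positive roots. -/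
def IsLongAbelianIdeal [P.IsReduced] [Finite ι] (b : P.Base) (B : P.InvariantForm)
    (I : Set V) : Prop :=
  IsAbelianIdeal b I ∧ I ⊆ longPosRoots b B

/-- The space `V̂ = V ⊕ ℝδ ⊕ ℝλ`; the triple `(v, s, t)` stands for `v + sδ + tλ`. -/
abbrev AffineSpace (V : Type*) : Type _ := V × ℝ × ℝ

/-- The vector `δ` of `V̂`. -/
def delta (V : Type*) [AddCommGroup V] : AffineSpace V := (0, 1, 0)

/-- The inclusion of `V` in `V̂`. -/
def incl (v : V) : AffineSpace V := (v, 0, 0)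

/-- The extension of a bilinear form on `V` to `V̂` such that
`(δ, V) = (λ, V) = (δ, δ) = (λ, λ) = 0` and `(δ, λ) = 1`. -/
def extForm (f : LinearMap.BilinForm ℝ V) : LinearMap.BilinForm ℝ (AffineSpace V) :=
  LinearMap.mk₂ ℝ (fun x y ↦ f x.1 y.1 + x.2.1 * y.2.2 + x.2.2 * y.2.1)
    (by intros; simp; ring) (by intros; simp; ring) (by intros; simp; ring)
    (by intros; simp; ring)

@[simp]
lemma extForm_apply (f : LinearMap.BilinForm ℝ V) (x y : AffineSpace V) :
    extForm f x y = f x.1 y.1 + x.2.1 * y.2.2 + x.2.2 * y.2.1 := rfl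

/-- The set `Δ̂⁺ = Δ⁺ ∪ {α + kδ | α ∈ Δ, k ≥ 1}` of positive affine real roots. -/
def posAffineRoots [P.IsReduced] [Finite ι] (b : P.Base) : Set (AffineSpace V) :=
  incl '' posRoots b ∪ {x | ∃ (i : ι) (k : ℤ), 1 ≤ k ∧ x = incl (P.root i) + (k : ℝ) • delta V}

/-- The affine simple roots: `some i` gives the simple root `α_i`, and `none` gives
`α₀ = δ - θ`. -/
def simpleAffineRoot (b : P.Base) (θ : ι) : Option b.support → AffineSpace V
  | none => delta V - incl (P.root θ)
  | some i => incl (P.root i)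

lemma extForm_simpleAffineRoot_ne_zero (b : P.Base) (θ : ι) (B : P.InvariantForm)
    (i : Option b.support) :
    extForm B.form (simpleAffineRoot b θ i) (simpleAffineRoot b θ i) ≠ 0 := by
  cases i with
  | none => simp [simpleAffineRoot, delta, incl, B.ne_zero θ]
  | some i => simp [simpleAffineRoot, incl, B.ne_zero i]

/-- The orthogonal reflection `y ↦ y - (2 (x, y) / (x, x)) x` of a space with a bilinear form, for
a non-isotropic vector `x`. -/
def orthReflection {E : Type*} [AddCommGroup E] [Module ℝ E] (f : LinearMap.BilinForm ℝ E)
    (x : E) (hx : f x x ≠ 0) : E ≃ₗ[ℝ] E :=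
  Module.reflection (x := x) (f := (2 / f x x) • f x) (by simp [hx])

/-- The simple reflections `s₀, s₁, …, s_p`, acting linearly on `V̂`. -/
def simpleReflection (b : P.Base) (θ : ι) (B : P.InvariantForm) (i : Option b.support) :
    AffineSpace V ≃ₗ[ℝ] AffineSpace V :=
  orthReflection (extForm B.form) (simpleAffineRoot b θ i)
    (extForm_simpleAffineRoot_ne_zero b θ B i)

/-- The affine Weyl group `Ŵ`, in its (faithful) linear action on `V̂`. -/
def affineWeylGroup (b : P.Base) (θ : ι) (B : P.InvariantForm) :
    Subgroup (AffineSpace V ≃ₗ[ℝ] AffineSpace V) :=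
  Subgroup.closure (Set.range (simpleReflection b θ B))

/-- The list `[i₁, …, i_k]` is a reduced decomposition of `w`, i.e. `w = s_{i₁} ⋯ s_{i_k}` with
`k` minimal. -/
def IsReducedDecomposition (b : P.Base) (θ : ι) (B : P.InvariantForm)
    (l : List (Option b.support)) (w : AffineSpace V ≃ₗ[ℝ] AffineSpace V) : Prop :=
  (l.map (simpleReflection b θ B)).prod = w ∧
    ∀ l' : List (Option b.support), (l'.map (simpleReflection b θ B)).prod = w →
      l.length ≤ l'.length

/-- The simple reflection `s_i` is short: it corresponds to a short simple root of `Δ`. The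
reflection `s₀` is regarded as long. -/
def IsShortReflection (b : P.Base) (B : P.InvariantForm) : Option b.support → Prop
  | none => False
  | some i => IsShort B i

/-- `N̂(w) = {α ∈ Δ̂⁺ | w(α) ∈ -Δ̂⁺}`. -/
def inversionSet [P.IsReduced] [Finite ι] (b : P.Base)
    (w : AffineSpace V ≃ₗ[ℝ] AffineSpace V) : Set (AffineSpace V) :=
  {α | α ∈ posAffineRoots b ∧ -(w α) ∈ posAffineRoots b}

/-- The set of minuscule elements: those `w ∈ Ŵ` such that `N̂(w) = {δ - γ | γ ∈ I}` for some
`I ⊆ Δ⁺`. -/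
def minuscule [P.IsReduced] [Finite ι] (b : P.Base) (θ : ι) (B : P.InvariantForm) :
    Set (AffineSpace V ≃ₗ[ℝ] AffineSpace V) :=
  {w | w ∈ affineWeylGroup b θ B ∧
    ∃ I ⊆ posRoots b, inversionSet b w = {x | ∃ γ ∈ I, x = delta V - incl γ}}

/-- `I_w = {γ ∈ Δ⁺ | δ - γ ∈ N̂(w)}`. -/
def idealOf [P.IsReduced] [Finite ι] (b : P.Base) (w : AffineSpace V ≃ₗ[ℝ] AffineSpace V) :
    Set V :=
  {γ | γ ∈ posRoots b ∧ delta V - incl γ ∈ inversionSet b w}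

/-- The set of long minuscule elements: those minuscule `w` for which `I_w` is a long Abelian
ideal. -/
def longMinuscule [P.IsReduced] [Finite ι] (b : P.Base) (θ : ι) (B : P.InvariantForm) :
    Set (AffineSpace V ≃ₗ[ℝ] AffineSpace V) :=
  {w | w ∈ minuscule b θ B ∧ IsLongAbelianIdeal b B (idealOf b w)}

end LongAbelian

end

/-! The lengths of the inversions of `w` are exactly the lengths of the simple affine roots
labelling any reduced decomposition. Simple reflections preserve the extended form, and `s_i` makes
only one positive affine root negative, namely `α_i` (`eq_simpleAffineRoot`). So an inversion is
carried to some `α_i` by the letters to the right of `s_i` (`exists_form_eq_of_inversion`).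
Conversely, by the exchange condition, every letter of a reduced word yields such an inversion
(`exists_inversion_of_mem`).

If `w` is minuscule, its inversions are `δ - γ` with `γ ∈ I_w`, and `δ - γ` has the length of `γ`.
Hence `I_w` is long iff no letter is short; `s₀` counts as long because `α₀` has the length of `θ`,
a long root (`IsHighestRoot.isLong`). That `I_w` is an Abelian ideal is automatic: positive affine
roots are closed under sums that are roots, and inversions have `δ`-coefficient 1. -/

noncomputable section

namespace LongAbelian

variable {ι V N : Type*} [AddCommGroup V] [Module ℝ V] [AddCommGroup N] [Module ℝ N]
  {P : RootPairing ι ℝ V N}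

/-! ### Heights and the highest root -/

/-- The linear extension of the height function to `V`. -/
def heightMap [P.IsRootSystem] (b : P.Base) : V →ₗ[ℝ] ℝ :=
  b.toWeightBasis.constr ℝ fun _ ↦ (1 : ℝ)

lemma heightMap_simple [P.IsRootSystem] (b : P.Base) {i : ι} (hi : i ∈ b.support) :
    heightMap b (P.root i) = 1 := by
  have := b.toWeightBasis.constr_basis ℝ (fun _ ↦ (1 : ℝ)) ⟨i, hi⟩
  simpa [heightMap] using this

lemma heightMap_root [P.IsRootSystem] (b : P.Base) (i : ι) :
    heightMap b (P.root i) = b.height i := by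
  obtain ⟨f, -, -, hf⟩ := b.exists_root_eq_sum_int i
  rw [b.height_eq_sum hf, hf, map_sum, Int.cast_sum]
  refine Finset.sum_congr rfl fun j hj ↦ ?_
  rw [map_zsmul, heightMap_simple b hj, zsmul_one]

lemma heightMap_closure [P.IsRootSystem] (b : P.Base) {x : V}
    (hx : x ∈ AddSubmonoid.closure (P.root '' b.support)) :
    0 ≤ heightMap b x ∧ (heightMap b x = 0 → x = 0) := by
  induction hx using AddSubmonoid.closure_induction with
  | mem x hx =>
    obtain ⟨i, hi, rfl⟩ := hx
    simp [heightMap_simple b hi]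
  | zero => simp
  | add x y _ _ hx hy =>
    rw [map_add]
    refine ⟨add_nonneg hx.1 hy.1, fun h ↦ ?_⟩
    rw [hx.2 (by linarith [hx.1, hy.1]), hy.2 (by linarith [hx.1, hy.1]), add_zero]

lemma IsHighestRoot.heightMap_le [P.IsRootSystem] {b : P.Base} {θ : ι} (hθ : IsHighestRoot b θ)
    (i : ι) : heightMap b (P.root i) ≤ heightMap b (P.root θ) := by
  have := (heightMap_closure b (hθ i)).1
  rwa [map_sub, sub_nonneg] at this

/-- A root whose height does not increase under simple reflections pairs non-negatively with
simple roots, hence with all non-negative combinations of simple roots. -/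
lemma form_nonneg_of_dominant [P.IsRootSystem] {b : P.Base} (B : P.InvariantForm)
    (hB : ∀ x : V, x ≠ 0 → 0 < B.form x x) {a : ι}
    (ha : ∀ i ∈ b.support,
      heightMap b (P.root (P.reflectionPerm i a)) ≤ heightMap b (P.root a))
    {x : V} (hx : x ∈ AddSubmonoid.closure (P.root '' b.support)) :
    0 ≤ B.form (P.root a) x := by
  induction hx using AddSubmonoid.closure_induction with
  | mem x hx =>
    obtain ⟨i, hi, rfl⟩ := hx
    have h := ha i hi
    -- Reflecting in a simple root lowers the height by the pairing, so `ha` makes the pairing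
    -- non-negative.
    rw [P.root_reflectionPerm, P.reflection_apply_root, map_sub, map_smul,
      heightMap_simple b hi, smul_eq_mul, mul_one] at h
    have h2 := B.two_mul_apply_root_root a i
    have h3 : 0 ≤ P.pairing a i * B.form (P.root i) (P.root i) :=
      mul_nonneg (by linarith) (hB _ (P.ne_zero i)).le
    linarith
  | zero => simp
  | add x y _ _ hx hy => rw [map_add]; exact add_nonneg hx hy

/-- The highest root is long. -/
lemma IsHighestRoot.isLong [Finite ι] [P.IsRootSystem] {b : P.Base} (B : P.InvariantForm)
    (hB : ∀ x : V, x ≠ 0 → 0 < B.form x x) {θ : ι} (hθ : IsHighestRoot b θ) :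
    IsLong B θ := by
  intro j
  -- The roots as long as `j` are stable under reflections, so a highest one among them, `a`, is
  -- dominant. As `θ` is dominant and `θ - a` lies in the cone, `(a, a) ≤ (a, θ) ≤ (θ, θ)`.
  let T := {k : ι // B.form (P.root k) (P.root k) = B.form (P.root j) (P.root j)}
  have : Nonempty T := ⟨⟨j, rfl⟩⟩
  obtain ⟨⟨a, ha⟩, hmax⟩ := Finite.exists_max fun k : T ↦ heightMap b (P.root k.1)
  have h1 := form_nonneg_of_dominant B hB (b := b) (a := a) (fun i _ ↦
    hmax ⟨P.reflectionPerm i a, by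
      rw [P.root_reflectionPerm, B.apply_reflection_reflection, ha]⟩) (hθ a)
  have h2 := form_nonneg_of_dominant B hB (b := b) (a := θ) (fun i _ ↦ hθ.heightMap_le _) (hθ a)
  rw [map_sub, sub_nonneg] at h1 h2
  have h3 : B.form (P.root a) (P.root θ) = B.form (P.root θ) (P.root a) := B.symm.eq _ _
  linarith

/-! ### Affine roots -/

/-- The set of affine real roots `α + kδ`. -/
def affineRoots (P : RootPairing ι ℝ V N) : Set (AffineSpace V) :=
  {x | ∃ (i : ι) (k : ℤ), x = (P.root i, (k : ℝ), (0 : ℝ))}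

lemma mem_posAffineRoots_iff [P.IsReduced] [Finite ι] (b : P.Base) (i : ι) (k : ℤ) :
    ((P.root i, (k : ℝ), (0 : ℝ)) : AffineSpace V) ∈ posAffineRoots b ↔
      1 ≤ k ∨ k = 0 ∧ b.IsPos i := by
  constructor
  · rintro (⟨_, ⟨j, hj, rfl⟩, h⟩ | ⟨j, l, hl, h⟩)
    · simp only [incl, Prod.mk.injEq, EmbeddingLike.apply_eq_iff_eq, and_true] at h
      obtain ⟨rfl, h⟩ := h
      exact Or.inr ⟨by exact_mod_cast h.symm, hj⟩
    · simp [incl, delta] at h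
      left; omega
  · rintro (h | ⟨rfl, h⟩)
    · exact Or.inr ⟨i, k, h, by simp [incl, delta]⟩
    · exact Or.inl ⟨_, ⟨i, h, rfl⟩, by simp [incl]⟩

lemma posAffineRoots_subset [P.IsReduced] [Finite ι] (b : P.Base) :
    posAffineRoots b ⊆ affineRoots P := by
  rintro _ (⟨_, ⟨j, hj, rfl⟩, rfl⟩ | ⟨j, l, hl, rfl⟩)
  · exact ⟨j, 0, by simp [incl]⟩
  · exact ⟨j, l, by simp [incl, delta]⟩

/-- A root reflected in itself changes sign, so `P.reflectionPerm i i` indexes the opposite root. -/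
lemma neg_mk_root (i : ι) (k : ℤ) :
    -((P.root i, (k : ℝ), (0 : ℝ)) : AffineSpace V) =
      (P.root (P.reflectionPerm i i), ((-k : ℤ) : ℝ), (0 : ℝ)) := by
  simp

lemma neg_mem_affineRoots {x : AffineSpace V} (hx : x ∈ affineRoots P) : -x ∈ affineRoots P := by
  obtain ⟨i, k, rfl⟩ := hx
  exact ⟨_, _, neg_mk_root i k⟩

lemma neg_mem_posAffineRoots_iff [P.IsReduced] [Finite ι] (b : P.Base) {x : AffineSpace V}
    (hx : x ∈ affineRoots P) : -x ∈ posAffineRoots b ↔ x ∉ posAffineRoots b := by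
  obtain ⟨i, k, rfl⟩ := hx
  have h : b.IsPos (P.reflectionPerm i i) ↔ ¬ b.IsPos i :=
    RootPairing.Base.IsPos.neg_iff_not b i
  rw [neg_mk_root, mem_posAffineRoots_iff, mem_posAffineRoots_iff, h]
  by_cases hi : b.IsPos i <;>
    simp only [hi, not_true_eq_false, not_false_eq_true, and_true, and_false, or_false] <;> omega

lemma add_mem_posAffineRoots [P.IsReduced] [Finite ι] (b : P.Base) {x y : AffineSpace V}
    (hx : x ∈ posAffineRoots b) (hy : y ∈ posAffineRoots b) (hxy : x + y ∈ affineRoots P) :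
    x + y ∈ posAffineRoots b := by
  obtain ⟨i, k, rfl⟩ := posAffineRoots_subset b hx
  obtain ⟨j, l, rfl⟩ := posAffineRoots_subset b hy
  obtain ⟨n, m, h⟩ := hxy
  rw [h, mem_posAffineRoots_iff]
  rw [mem_posAffineRoots_iff] at hx hy
  simp only [Prod.mk_add_mk, Prod.mk.injEq] at h
  obtain ⟨h1, h2, -⟩ := h
  have h2 : k + l = m := by exact_mod_cast h2
  rcases hx with hx | ⟨rfl, hx⟩
  · left; omega
  rcases hy with hy | ⟨rfl, hy⟩
  · left; omega
  · exact Or.inr ⟨by omega, hx.add hy h1.symm⟩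

lemma simpleAffineRoot_mem_posAffineRoots [P.IsReduced] [Finite ι] (b : P.Base) (θ : ι)
    (i : Option b.support) : simpleAffineRoot b θ i ∈ posAffineRoots b := by
  cases i with
  | none =>
    have : simpleAffineRoot b θ none =
        (P.root (P.reflectionPerm θ θ), ((1 : ℤ) : ℝ), (0 : ℝ)) := by
      simp [simpleAffineRoot, delta, incl]
    rw [this, mem_posAffineRoots_iff]
    exact Or.inl le_rfl
  | some i => exact Or.inl ⟨_, ⟨i, RootPairing.Base.isPos_of_mem_support i.2, rfl⟩, rfl⟩

/-! ### The affine Weyl group -/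

section Reflection

variable {E : Type*} [AddCommGroup E] [Module ℝ E] (f : LinearMap.BilinForm ℝ E)

lemma orthReflection_apply (x : E) (hx : f x x ≠ 0) (y : E) :
    orthReflection f x hx y = y - (2 * f x y / f x x) • x := by
  simp [orthReflection, Module.reflection_apply, div_mul_eq_mul_div]

lemma orthReflection_self (x : E) (hx : f x x ≠ 0) : orthReflection f x hx x = -x := by
  rw [orthReflection_apply, mul_div_assoc, div_self hx, mul_one, two_smul]
  abel

lemma orthReflection_mul_self (x : E) (hx : f x x ≠ 0) :
    orthReflection f x hx * orthReflection f x hx = 1 := by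
  ext y
  exact Module.involutive_reflection _ y

lemma form_orthReflection (hf : f.IsSymm) (x : E) (hx : f x x ≠ 0) (y z : E) :
    f (orthReflection f x hx y) (orthReflection f x hx z) = f y z := by
  have h : f y x = f x y := hf.eq _ _
  simp only [orthReflection_apply, map_sub, map_smul, LinearMap.sub_apply, LinearMap.smul_apply,
    smul_eq_mul, h]
  field_simp
  ring

/-- This turns an equality of roots into a relation between group elements, as the exchange
condition requires. -/
lemma orthReflection_conj (g : E ≃ₗ[ℝ] E) (hg : ∀ y z, f (g y) (g z) = f y z) {x x' : E}
    (hx : f x x ≠ 0) (hx' : f x' x' ≠ 0) (h : g x = x') :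
    g * orthReflection f x hx = orthReflection f x' hx' * g := by
  subst h
  ext y
  simp [orthReflection_apply, hg]

end Reflection

lemma extForm_isSymm (B : P.InvariantForm) : (extForm B.form).IsSymm := by
  refine ⟨fun x y ↦ ?_⟩
  have h : B.form x.1 y.1 = B.form y.1 x.1 := B.symm.eq _ _
  simp only [extForm_apply, h]
  ring

lemma simpleReflection_mul_self (b : P.Base) (θ : ι) (B : P.InvariantForm)
    (i : Option b.support) : simpleReflection b θ B i * simpleReflection b θ B i = 1 :=
  orthReflection_mul_self _ _ _

lemma simpleReflection_inv (b : P.Base) (θ : ι) (B : P.InvariantForm)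
    (i : Option b.support) : (simpleReflection b θ B i)⁻¹ = simpleReflection b θ B i :=
  inv_eq_of_mul_eq_one_left (simpleReflection_mul_self b θ B i)

/-- Since `δ` is orthogonal to vectors without `λ`-part, `s₀` reflects the finite part in `θ`; the
multiple of `δ - θ` it adds shifts the level. -/
lemma simpleReflection_mk_root (b : P.Base) (θ : ι) (B : P.InvariantForm) (j : Option b.support)
    (i : ι) (k : ℝ) :
    simpleReflection b θ B j (P.root i, k, 0) =
      j.elim (P.root (P.reflectionPerm θ i), k + P.pairing i θ, 0)
        (fun j ↦ (P.root (P.reflectionPerm j i), k, 0)) := by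
  have key (a : ι) : 2 * B.form (P.root a) (P.root i) / B.form (P.root a) (P.root a) =
      P.pairing i a := by
    have : B.form (P.root a) (P.root i) = B.form (P.root i) (P.root a) := B.symm.eq _ _
    rw [this, B.two_mul_apply_root_root, mul_div_assoc, div_self (B.ne_zero a), mul_one]
  cases j with
  | none =>
    simp [simpleReflection, orthReflection_apply, simpleAffineRoot, delta, incl, neg_div, key,
      P.reflection_apply_root, sub_eq_add_neg]
  | some j =>
    simp [simpleReflection, orthReflection_apply, simpleAffineRoot, incl, key,
      P.reflection_apply_root]

lemma simpleReflection_mem_affineRoots [P.IsCrystallographic] (b : P.Base) (θ : ι)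
    (B : P.InvariantForm) (j : Option b.support) {x : AffineSpace V} (hx : x ∈ affineRoots P) :
    simpleReflection b θ B j x ∈ affineRoots P := by
  obtain ⟨i, k, rfl⟩ := hx
  rw [simpleReflection_mk_root]
  cases j with
  | none =>
    refine ⟨P.reflectionPerm θ i, k + P.pairingIn ℤ i θ, ?_⟩
    have : (P.pairingIn ℤ i θ : ℝ) = P.pairing i θ := P.algebraMap_pairingIn ℤ i θ
    simp [this]
  | some j => exact ⟨P.reflectionPerm j i, k, rfl⟩

/-- The only positive affine root made negative by a simple reflection is the corresponding
simple affine root. -/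
lemma eq_simpleAffineRoot [Finite ι] [P.IsRootSystem] [P.IsCrystallographic] [P.IsReduced]
    (b : P.Base) {θ : ι} (hθ : IsHighestRoot b θ) (B : P.InvariantForm) (j : Option b.support)
    {x : AffineSpace V} (hx : x ∈ posAffineRoots b)
    (hjx : simpleReflection b θ B j x ∉ posAffineRoots b) :
    x = simpleAffineRoot b θ j := by
  cases j with
  | some j =>
    obtain ⟨i, k, rfl⟩ := posAffineRoots_subset b hx
    rw [simpleReflection_mk_root, Option.elim_some, mem_posAffineRoots_iff] at hjx
    rw [mem_posAffineRoots_iff] at hx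
    push Not at hjx
    rcases hx with hx | ⟨rfl, hx⟩
    · omega
    -- At level 0, a simple reflection permutes the positive roots other than its own.
    have : i = j := by
      by_contra hij
      exact hjx.2 rfl (hx.reflectionPerm j.2 hij)
    simp [simpleAffineRoot, incl, this]
  | none =>
    -- The functional `ht(v) + s · ht(θ)` kills `α₀`, hence is `s₀`-invariant. It is non-negative on
    -- positive affine roots and vanishes only at `α₀`; positivity of both `x` and `-s₀ x` therefore
    -- forces it to vanish at `x`.
    have aux {y : AffineSpace V} (hy : y ∈ posAffineRoots b) :
        0 ≤ heightMap b y.1 + y.2.1 * heightMap b (P.root θ) ∧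
          (heightMap b y.1 + y.2.1 * heightMap b (P.root θ) = 0 →
            y = simpleAffineRoot b θ none) := by
      have hθ0 : 0 < heightMap b (P.root θ) := by
        have h := hθ.heightMap_le (P.reflectionPerm θ θ)
        have h' := b.height_ne_zero θ
        rw [P.root_reflectionPerm, P.reflection_apply_self, map_neg] at h
        have h2 : heightMap b (P.root θ) ≠ 0 := by
          rw [heightMap_root]; exact_mod_cast h'
        exact lt_of_le_of_ne (by linarith) h2.symm
      obtain ⟨i, k, rfl⟩ := posAffineRoots_subset b hy
      rw [mem_posAffineRoots_iff] at hy
      dsimp only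
      rcases hy with hy | ⟨rfl, hy⟩
      · have hc := heightMap_closure b (hθ (P.reflectionPerm i i))
        rw [P.root_reflectionPerm, P.reflection_apply_self, sub_neg_eq_add, map_add] at hc
        have hk : (1 : ℝ) ≤ k := by exact_mod_cast hy
        have hm : heightMap b (P.root θ) ≤ k * heightMap b (P.root θ) :=
          le_mul_of_one_le_left hθ0.le hk
        refine ⟨by linarith [hc.1], fun h0 ↦ ?_⟩
        have h1 := hc.2 (by linarith [hc.1])
        have h2 : ((k : ℝ) - 1) * heightMap b (P.root θ) = 0 := by linarith [hc.1]
        have h3 : (k : ℝ) = 1 := by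
          rcases mul_eq_zero.mp h2 with h | h <;> linarith
        simp [simpleAffineRoot, delta, incl, h3, eq_neg_of_add_eq_zero_right h1]
      · have : 0 < heightMap b (P.root i) := by
          rw [heightMap_root]; exact_mod_cast (show 0 < b.height i from hy)
        rw [Int.cast_zero, zero_mul, add_zero]
        exact ⟨this.le, fun h ↦ absurd h this.ne'⟩
    have hxa := posAffineRoots_subset b hx
    have hneg := (neg_mem_posAffineRoots_iff b
      (simpleReflection_mem_affineRoots b θ B none hxa)).mpr hjx
    have h1 := aux hx
    have h2 := (aux hneg).1
    refine h1.2 (le_antisymm ?_ h1.1)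
    simp only [simpleReflection, orthReflection_apply, simpleAffineRoot, delta, incl, Prod.fst_neg,
      Prod.snd_neg, Prod.fst_sub, Prod.snd_sub, Prod.smul_fst, Prod.smul_snd, map_neg, map_sub,
      map_smul, smul_eq_mul, map_zero] at h2
    linarith

/-! ### Words, inversions and the exchange condition -/

section Words

variable (b : P.Base) (θ : ι) (B : P.InvariantForm)

/-- The element of the affine Weyl group given by a word in the simple reflections. -/
def wordProd (l : List (Option b.support)) : AffineSpace V ≃ₗ[ℝ] AffineSpace V :=
  (l.map (simpleReflection b θ B)).prod

@[simp] lemma wordProd_nil : wordProd b θ B [] = 1 := rfl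

@[simp] lemma wordProd_cons (i : Option b.support) (l : List (Option b.support)) :
    wordProd b θ B (i :: l) = simpleReflection b θ B i * wordProd b θ B l := by
  simp [wordProd]

@[simp] lemma wordProd_append (l l' : List (Option b.support)) :
    wordProd b θ B (l ++ l') = wordProd b θ B l * wordProd b θ B l' := by
  simp [wordProd]

lemma wordProd_reverse (l : List (Option b.support)) :
    wordProd b θ B l.reverse = (wordProd b θ B l)⁻¹ := by
  induction l with
  | nil => simp
  | cons i l ih => simp [ih, simpleReflection_inv]

lemma form_wordProd (l : List (Option b.support)) (x y : AffineSpace V) :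
    extForm B.form (wordProd b θ B l x) (wordProd b θ B l y) = extForm B.form x y := by
  induction l with
  | nil => rfl
  | cons i l ih =>
    rw [wordProd_cons, LinearEquiv.mul_apply, LinearEquiv.mul_apply, ← ih]
    exact form_orthReflection _ (extForm_isSymm B) _ _ _ _

lemma wordProd_mem_affineRoots [P.IsCrystallographic] (l : List (Option b.support))
    {x : AffineSpace V} (hx : x ∈ affineRoots P) : wordProd b θ B l x ∈ affineRoots P := by
  induction l with
  | nil => exact hx
  | cons i l ih =>
    rw [wordProd_cons, LinearEquiv.mul_apply]
    exact simpleReflection_mem_affineRoots b θ B i ih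

lemma exists_wordProd_eq {w : AffineSpace V ≃ₗ[ℝ] AffineSpace V}
    (hw : w ∈ affineWeylGroup b θ B) : ∃ l, wordProd b θ B l = w := by
  induction hw using Subgroup.closure_induction with
  | mem x hx =>
    obtain ⟨i, rfl⟩ := hx
    exact ⟨[i], by simp⟩
  | one => exact ⟨[], rfl⟩
  | mul x y _ _ hx hy =>
    obtain ⟨l, rfl⟩ := hx
    obtain ⟨l', rfl⟩ := hy
    exact ⟨l ++ l', by simp⟩
  | inv x _ hx =>
    obtain ⟨l, rfl⟩ := hx
    exact ⟨l.reverse, wordProd_reverse b θ B l⟩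

lemma exists_isReducedDecomposition {w : AffineSpace V ≃ₗ[ℝ] AffineSpace V}
    (hw : w ∈ affineWeylGroup b θ B) : ∃ l, IsReducedDecomposition b θ B l w := by
  classical
  obtain ⟨l, hl⟩ := exists_wordProd_eq b θ B hw
  have hex : ∃ n, ∃ l : List (Option b.support), l.length = n ∧ wordProd b θ B l = w :=
    ⟨_, l, rfl, hl⟩
  obtain ⟨l, hl, hlw⟩ := Nat.find_spec hex
  exact ⟨l, hlw, fun l' hl' ↦ hl ▸ Nat.find_min' hex ⟨l', rfl, hl'⟩⟩

variable [Finite ι] [P.IsRootSystem] [P.IsCrystallographic] [P.IsReduced] {θ}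

/-- A positive affine root made negative by a word has the length of the simple affine root of
one of the letters of the word. -/
lemma exists_form_eq_of_inversion (hθ : IsHighestRoot b θ) (l : List (Option b.support))
    {x : AffineSpace V} (hx : x ∈ posAffineRoots b)
    (hl : wordProd b θ B l x ∉ posAffineRoots b) :
    ∃ i ∈ l, extForm B.form x x =
      extForm B.form (simpleAffineRoot b θ i) (simpleAffineRoot b θ i) := by
  induction l with
  | nil => exact absurd hx hl
  | cons j l ih =>
    by_cases h : wordProd b θ B l x ∈ posAffineRoots b
    · refine ⟨j, by simp, ?_⟩
      rw [← eq_simpleAffineRoot b hθ B j h (by simpa using hl), form_wordProd]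
    · obtain ⟨i, hi, hix⟩ := ih h
      exact ⟨i, by simp [hi], hix⟩

/-- The exchange condition. -/
lemma exists_shorter_word (hθ : IsHighestRoot b θ) (l : List (Option b.support))
    (i : Option b.support)
    (hl : wordProd b θ B l (simpleAffineRoot b θ i) ∉ posAffineRoots b) :
    ∃ l' : List (Option b.support), l'.length < l.length + 1 ∧
      wordProd b θ B l' = wordProd b θ B l * simpleReflection b θ B i := by
  induction l with
  | nil => exact absurd (simpleAffineRoot_mem_posAffineRoots b θ i) hl
  | cons j l ih =>
    by_cases h : wordProd b θ B l (simpleAffineRoot b θ i) ∈ posAffineRoots b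
    -- Here `l` sends `α_i` to `α_j`, so `l s_i = s_j l` and the letter `j` cancels.
    · have h1 := eq_simpleAffineRoot b hθ B j h (by simpa using hl)
      have h2 : wordProd b θ B l * simpleReflection b θ B i =
          simpleReflection b θ B j * wordProd b θ B l :=
        orthReflection_conj _ _ (form_wordProd b θ B l) _ _ h1
      refine ⟨l, by simp, ?_⟩
      rw [wordProd_cons, mul_assoc, h2, ← mul_assoc, simpleReflection_mul_self, one_mul]
    · obtain ⟨l', hl', h'⟩ := ih h
      refine ⟨j :: l', by simpa using hl', ?_⟩
      rw [wordProd_cons, h', wordProd_cons, mul_assoc]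

/-- Every letter of a reduced decomposition of `w` gives an inversion of `w` having the length of
the corresponding simple affine root. -/
lemma exists_inversion_of_mem (hθ : IsHighestRoot b θ)
    {w : AffineSpace V ≃ₗ[ℝ] AffineSpace V}
    {l : List (Option b.support)} (hl : IsReducedDecomposition b θ B l w) {i : Option b.support}
    (hi : i ∈ l) :
    ∃ x ∈ inversionSet b w, extForm B.form x x =
      extForm B.form (simpleAffineRoot b θ i) (simpleAffineRoot b θ i) := by
  obtain ⟨l₁, l₂, rfl⟩ := List.append_of_mem hi
  obtain ⟨rfl, hmin⟩ := hl
  change ∃ x ∈ inversionSet b (wordProd b θ B (l₁ ++ i :: l₂)), _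
  replace hmin (l' : List (Option b.support))
      (h : wordProd b θ B l' = wordProd b θ B (l₁ ++ i :: l₂)) :
      (l₁ ++ i :: l₂).length ≤ l'.length := hmin l' h
  -- The inversion is `l₂⁻¹ α_i`, sent by `w` to `-l₁ α_i`. If either `l₁ α_i` or `l₂⁻¹ α_i` were
  -- negative, exchange would shorten the word.
  have h1 : wordProd b θ B l₁ (simpleAffineRoot b θ i) ∈ posAffineRoots b := by
    by_contra h
    obtain ⟨l', hlen, h'⟩ := exists_shorter_word b B hθ l₁ i h
    have := hmin (l' ++ l₂) (by simp [h', mul_assoc])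
    simp at this
    omega
  have h2 : wordProd b θ B l₂.reverse (simpleAffineRoot b θ i) ∈ posAffineRoots b := by
    by_contra h
    obtain ⟨l', hlen, h'⟩ := exists_shorter_word b B hθ l₂.reverse i h
    have := hmin (l₁ ++ l'.reverse)
      (by simp [wordProd_reverse, h', simpleReflection_inv])
    simp at this hlen
    omega
  refine ⟨_, ⟨h2, ?_⟩, form_wordProd b θ B _ _ _⟩
  have h3 : wordProd b θ B (l₁ ++ i :: l₂) (wordProd b θ B l₂.reverse (simpleAffineRoot b θ i)) =
      -wordProd b θ B l₁ (simpleAffineRoot b θ i) := by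
    rw [← LinearEquiv.mul_apply, wordProd_reverse, wordProd_append, wordProd_cons, mul_assoc,
      mul_assoc, mul_inv_cancel, mul_one, LinearEquiv.mul_apply, ← map_neg]
    congr 1
    exact orthReflection_self _ _ _
  rwa [h3, neg_neg]

end Words

/-! ### Minuscule elements -/

/-- The set `I_w` of a minuscule element is an Abelian ideal. -/
lemma isAbelianIdeal_idealOf [Finite ι] [P.IsCrystallographic] [P.IsReduced]
    (b : P.Base) {θ : ι} (B : P.InvariantForm) {w : AffineSpace V ≃ₗ[ℝ] AffineSpace V}
    (hw : w ∈ minuscule b θ B) : IsAbelianIdeal b (idealOf b w) := by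
  obtain ⟨hwW, I, -, hI⟩ := hw
  have hmem {x : AffineSpace V} (hx : x ∈ inversionSet b w) : x.2.1 = 1 := by
    rw [hI] at hx
    obtain ⟨γ, -, rfl⟩ := hx
    simp [delta, incl]
  obtain ⟨l, rfl⟩ := exists_wordProd_eq b θ B hwW
  have hw {x : AffineSpace V} (hx : x ∈ affineRoots P) := wordProd_mem_affineRoots b θ B l hx
  refine ⟨fun γ hγ ↦ hγ.1, fun μ hμ ν hν hμν ↦ ?_, fun γ hγ ν hν hγν ↦ ?_⟩
  · obtain ⟨i, hi⟩ := hμν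
    -- If `μ + ν` were a root, `2δ - (μ + ν)` would be an inversion at level 2.
    have ha : (delta V - incl μ) + (delta V - incl ν) ∈ affineRoots P := by
      refine ⟨P.reflectionPerm i i, 2, ?_⟩
      rw [P.root_reflectionPerm, P.reflection_apply_self, hi]
      simp [delta, incl, one_add_one_eq_two, add_comm]
    have hinv : (delta V - incl μ) + (delta V - incl ν) ∈
        inversionSet b (wordProd b θ B l) := by
      refine ⟨add_mem_posAffineRoots b hμ.2.1 hν.2.1 ha, ?_⟩
      rw [map_add, neg_add]
      refine add_mem_posAffineRoots b hμ.2.2 hν.2.2 ?_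
      rw [← neg_add, ← map_add]
      exact neg_mem_affineRoots (hw ha)
    have := hmem hinv
    norm_num [delta, incl] at this
  · obtain ⟨i, hi⟩ := hγν
    -- The root `ν` has level 0, so `w` keeps it positive. Were `w(δ - (γ + ν))` positive too, so
    -- would be their sum `w(δ - γ)`.
    have hsum : (delta V - incl (γ + ν)) + incl ν = delta V - incl γ := by
      simp [delta, incl]
    obtain ⟨j, hj, rfl⟩ := hγ.1
    obtain ⟨k, hk, rfl⟩ := hν
    have hνpos : incl (P.root k) ∈ posAffineRoots b := Or.inl ⟨_, ⟨k, hk, rfl⟩, rfl⟩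
    have hpos : delta V - incl (P.root j + P.root k) ∈ posAffineRoots b := by
      refine Or.inr ⟨P.reflectionPerm i i, 1, le_rfl, ?_⟩
      rw [P.root_reflectionPerm, P.reflection_apply_self, hi]
      simp [delta, incl]
    have hνw : wordProd b θ B l (incl (P.root k)) ∈ posAffineRoots b := by
      by_contra h
      have := hmem (x := incl (P.root k)) ⟨hνpos,
        (neg_mem_posAffineRoots_iff b (hw (posAffineRoots_subset b hνpos))).mpr h⟩
      simp [incl] at this
    refine ⟨⟨i, hj.add hk hi, hi⟩, hpos, ?_⟩
    rw [neg_mem_posAffineRoots_iff b (hw (posAffineRoots_subset b hpos))]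
    intro h
    have hγa := hw (posAffineRoots_subset b hγ.2.1)
    refine (neg_mem_posAffineRoots_iff b hγa).mp hγ.2.2 ?_
    rw [← hsum, map_add]
    refine add_mem_posAffineRoots b h hνw ?_
    rwa [← map_add, hsum]

lemma extForm_delta_sub_incl (B : P.InvariantForm) (γ : V) :
    extForm B.form (delta V - incl γ) (delta V - incl γ) = B.form γ γ := by
  simp [delta, incl]

lemma isLong_iff_not_isShort (B : P.InvariantForm) (i : ι) : IsLong B i ↔ ¬ IsShort B i := by
  simp [IsLong, IsShort]

end LongAbelian

end

/-! ### The proposition -/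

theorem mainTheorem4 {ι V N : Type*} [Finite ι] [AddCommGroup V] [Module ℝ V]
    [AddCommGroup N] [Module ℝ N]
    (P : RootPairing ι ℝ V N) [P.IsRootSystem] [P.IsCrystallographic] [P.IsReduced]
    [P.IsIrreducible] (b : P.Base)
    (B : P.InvariantForm) (hB : ∀ x : V, x ≠ 0 → 0 < B.form x x)
    (two_lengths : ∃ i j, B.form (P.root i) (P.root i) ≠ B.form (P.root j) (P.root j))
    (θ : ι) (hθ : LongAbelian.IsHighestRoot b θ)
    (w : LongAbelian.AffineSpace V ≃ₗ[ℝ] LongAbelian.AffineSpace V)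
    (hw : w ∈ LongAbelian.minuscule b θ B) :
    w ∈ LongAbelian.longMinuscule b θ B ↔
      ∀ l : List (Option b.support), LongAbelian.IsReducedDecomposition b θ B l w →
        ∀ i ∈ l, ¬ LongAbelian.IsShortReflection b B i := by
  open LongAbelian in
  constructor
  · rintro ⟨-, -, hlong⟩ l hl (_ | i) hi hshort
    · exact hshort
    obtain ⟨x, hx, hlen⟩ := exists_inversion_of_mem b B hθ hl hi
    obtain ⟨-, I, hIpos, hI⟩ := hw
    have hx' := hx
    rw [hI] at hx'
    obtain ⟨γ, hγ, rfl⟩ := hx'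
    obtain ⟨j, -, hj, rfl⟩ := hlong ⟨hIpos hγ, hx⟩
    rw [extForm_delta_sub_incl] at hlen
    obtain ⟨k, hk⟩ : IsShort B i := hshort
    have := hj k
    simp [simpleAffineRoot, incl] at hlen
    linarith
  · intro h
    -- A single reduced decomposition suffices in this direction.
    obtain ⟨l, hl⟩ := exists_isReducedDecomposition b θ B hw.1
    refine ⟨hw, isAbelianIdeal_idealOf b B hw, ?_⟩
    rintro _ ⟨⟨j, hj, rfl⟩, hpos, hneg⟩
    refine ⟨j, hj, ?_, rfl⟩
    have hwa : wordProd b θ B l = w := hl.1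
    subst hwa
    obtain ⟨i, hi, hlen⟩ := exists_form_eq_of_inversion b B hθ l hpos
      ((neg_mem_posAffineRoots_iff b (wordProd_mem_affineRoots b θ B l
        (posAffineRoots_subset b hpos))).mp hneg)
    rw [extForm_delta_sub_incl] at hlen
    obtain ⟨k, hk, hjk⟩ : ∃ k, IsLong B k ∧
        B.form (P.root j) (P.root j) = B.form (P.root k) (P.root k) := by
      cases i with
      | none =>
        exact ⟨θ, hθ.isLong B hB, by rw [hlen]; exact extForm_delta_sub_incl B _⟩
      | some i =>
        exact ⟨i, (isLong_iff_not_isShort B i).mpr (h l hl _ hi), by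
          simpa [simpleAffineRoot, incl] using hlen⟩
    intro m
    rw [hjk]
    exact hk m
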